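/- For $c\in\mathbb{R}$ let $(c)_n=c(c+1)\cdots(c+n-1)$, $(c)_0=1$, and for positive $a_1,a_2,b_1,b_2,b_3$ put $$\Phi(x)={}_2F_3\left[\begin{array}{c}a_1,a_2\\ b_1,b_2,b_3\end{array}\Big|\,-x^2\right]=\sum_{n=0}^\infty\frac{(a_1)_n(a_2)_n}{n!\,(b_1)_n(b_2)_n(b_3)_n}(-x^2)^n\qquad(x>0).$$ For $a_1,a_2>0$ let $\mathcal A\subset\mathbb{R}^3$ be the set of all permutations of $(a_2,\,a_1+\tfrac12,\,2a_1)$, let $\xi_1\le\xi_2\le\xi_3$ be the numbers $a_2,\,a_1+\tfrac12,\,2a_1$ arranged in ascending order, and let the Newton polyhedron $\Gamma_+(\mathcal A)$ be the convex hull of $\bigcup_{\mathbf x\in\mathcal A}(\mathbf x+[0,\infty)^3)$. Let $\Lambda$ be the set of $(a_1,a_2)$ with $a_1,a_2>0$ such that $$\begin{cases} a_2\le\frac12\left(3a_1+\frac12\right)\ \text{ or }\ 1\le a_2\le 2a_1+1 & \text{if } a_1\le\frac12,\\[2pt] a_2\le\max\left[a_1+\frac32,\ \frac32\left(a_1+\frac12\right)\right]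 & \text{if } a_1\ge\frac12.\end{cases}$$ **Theorem.** (i) If $(a_1,a_2)\in\Lambda$ and $(b_1,b_2,b_3)\in\Gamma_+(\mathcal A)$, then $\Phi(x)\ge 0$ for all $x>0$; moreover, if $(b_1,b_2,b_3)\notin\mathcal A$, then $\Phi(x)>0$ for all $x>0$. (ii) For all $a_1,a_2>0$, the set $\Gamma_+(\mathcal A)$ consists exactly of the points $(b_1,b_2,b_3)\in\mathbb{R}^3$ satisfying $$\min(b_1,b_2,b_3)\ge\xi_1,\qquad \min(b_1+b_2,\;b_2+b_3,\;b_1+b_3)\ge\xi_1+\xi_2,\qquad b_1+b_2+b_3\ge 3a_1+a_2+\tfrac12 .$$ -/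

import Mathlib

/-- The `n`-th term `(a₁)ₙ (a₂)ₙ / (n! (b₁)ₙ (b₂)ₙ (b₃)ₙ) · zⁿ` of the `₂F₃` series;
`(ascPochhammer ℝ n).eval c` is the Pochhammer symbol `(c)ₙ = c (c + 1) ⋯ (c + n - 1)`. -/
noncomputable def twoFThreeTerm (a₁ a₂ : ℝ) (b : Fin 3 → ℝ) (z : ℝ) (n : ℕ) : ℝ :=
  ((ascPochhammer ℝ n).eval a₁ * (ascPochhammer ℝ n).eval a₂) /
    ((n.factorial : ℝ) * ((ascPochhammer ℝ n).eval (b 0) * (ascPochhammer ℝ n).eval (b 1) *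
      (ascPochhammer ℝ n).eval (b 2))) * z ^ n

/-- The hypergeometric function `₂F₃[a₁, a₂; b₁, b₂, b₃ | z]` of a real argument. -/
noncomputable def twoFThree (a₁ a₂ : ℝ) (b : Fin 3 → ℝ) (z : ℝ) : ℝ :=
  ∑' n : ℕ, twoFThreeTerm a₁ a₂ b z n

/-- For positive parameters the series converges for every argument, so that `twoFThree` is a
genuine sum. -/
theorem summable_twoFThreeTerm {a₁ a₂ : ℝ} {b : Fin 3 → ℝ} (ha₁ : 0 < a₁) (ha₂ : 0 < a₂)
    (hb : ∀ i, 0 < b i) (z : ℝ) : Summable (twoFThreeTerm a₁ a₂ b z) := by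
  rcases eq_or_ne z 0 with rfl | hz
  · refine summable_of_ne_finset_zero (s := {0}) fun n hn => ?_
    have : n ≠ 0 := by simpa using hn
    simp [twoFThreeTerm, this]
  have hpos : ∀ (n : ℕ) (c : ℝ), 0 < c → (ascPochhammer ℝ n).eval c ≠ 0 :=
    fun n c hc => (ascPochhammer_pos n c hc).ne'
  have hne : ∀ n, twoFThreeTerm a₁ a₂ b z n ≠ 0 := fun n => by
    have := hpos n; have hf : (n.factorial : ℝ) ≠ 0 := by positivity
    unfold twoFThreeTerm
    have h0 := this _ (hb 0); have h1 := this _ (hb 1); have h2 := this _ (hb 2)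
    have h3 := this _ ha₁; have h4 := this _ ha₂
    positivity
  have hratio : ∀ n : ℕ, ‖twoFThreeTerm a₁ a₂ b z (n + 1)‖ / ‖twoFThreeTerm a₁ a₂ b z n‖ =
      |(a₁ + n) / (b 0 + n) * ((a₂ + n) / (b 1 + n)) * (z / (b 2 + n)) * (1 / ((n : ℝ) + 1))| := by
    intro n
    rw [← norm_div, Real.norm_eq_abs]
    congr 1
    have := hpos n
    have h0 := this _ (hb 0); have h1 := this _ (hb 1); have h2 := this _ (hb 2)
    have h3 := this _ ha₁; have h4 := this _ ha₂
    have hf : (n.factorial : ℝ) ≠ 0 := by positivity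
    have k0 : b 0 + n ≠ 0 := by have := hb 0; positivity
    have k1 : b 1 + n ≠ 0 := by have := hb 1; positivity
    have k2 : b 2 + n ≠ 0 := by have := hb 2; positivity
    have k3 : (n : ℝ) + 1 ≠ 0 := by positivity
    simp only [twoFThreeTerm, ascPochhammer_succ_eval, Nat.factorial_succ, Nat.cast_mul,
      Nat.cast_add, Nat.cast_one, pow_succ]
    field_simp
  have hlin : ∀ c : ℝ, Filter.Tendsto (fun n : ℕ => c + (n : ℝ)) Filter.atTop Filter.atTop :=
    fun c => Filter.tendsto_atTop_add_const_left _ c tendsto_natCast_atTop_atTop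
  have hone : ∀ c d : ℝ, 0 < d → Filter.Tendsto (fun n : ℕ => (c + n) / (d + n)) Filter.atTop
      (nhds 1) := by
    intro c d hd
    have h : Filter.Tendsto (fun n : ℕ => 1 + (c - d) / (d + (n : ℝ))) Filter.atTop
        (nhds (1 + 0)) := tendsto_const_nhds.add ((hlin d).const_div_atTop _)
    rw [add_zero] at h
    refine h.congr fun n => ?_
    have : d + (n : ℝ) ≠ 0 := by positivity
    field_simp
    ring
  refine summable_of_ratio_test_tendsto_lt_one (l := 0) one_pos
    (Filter.Eventually.of_forall hne) ?_
  simp only [hratio]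
  have h := ((((hone a₁ _ (hb 0)).mul (hone a₂ _ (hb 1))).mul
    ((hlin (b 2)).const_div_atTop z)).mul tendsto_one_div_add_atTop_nhds_zero_nat).abs
  simpa using h

/-- The admissible set `Λ` of pairs `(a₁, a₂)`. -/
def admissible : Set (ℝ × ℝ) :=
  {a | 0 < a.1 ∧ 0 < a.2 ∧
    (a.1 ≤ 1 / 2 →
      a.2 ≤ 1 / 2 * (3 * a.1 + 1 / 2) ∨ (1 ≤ a.2 ∧ a.2 ≤ 2 * a.1 + 1)) ∧
    (1 / 2 ≤ a.1 → a.2 ≤ max (a.1 + 3 / 2) (3 / 2 * (a.1 + 1 / 2)))}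

/-- The point `(a₂, a₁ + 1/2, 2 a₁)`. -/
noncomputable def basePoint (a₁ a₂ : ℝ) : Fin 3 → ℝ := ![a₂, a₁ + 1 / 2, 2 * a₁]

/-- The set `𝒜` of all permutations of `(a₂, a₁ + 1/2, 2 a₁)`. -/
def vertexSet (a₁ a₂ : ℝ) : Set (Fin 3 → ℝ) :=
  Set.range fun σ : Equiv.Perm (Fin 3) => basePoint a₁ a₂ ∘ σ

/-- `ξ 0 ≤ ξ 1 ≤ ξ 2`: the arrangement of `a₂, a₁ + 1/2, 2 a₁` in ascending order
(`ξ₁, ξ₂, ξ₃` when counting from one). -/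
noncomputable def xi (a₁ a₂ : ℝ) : Fin 3 → ℝ :=
  basePoint a₁ a₂ ∘ Tuple.sort (basePoint a₁ a₂)

/-- The Newton polyhedron `Γ₊(E)`: the convex hull of the union of the octants `x + [0, ∞)³`,
`x ∈ E`. The order on `Fin 3 → ℝ` is coordinatewise, so that octant is `Set.Ici x`. -/
def newtonPolyhedron (E : Set (Fin 3 → ℝ)) : Set (Fin 3 → ℝ) :=
  convexHull ℝ (⋃ x ∈ E, Set.Ici x)

/-!
For the parameters `ξ = (a₂, a₁ + 1/2, 2 a₁)` the product formula for Bessel functions turns the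
series at `z` into the square `₀F₁[a₁ + 1/2 | z / 4] ^ 2`. Passing from `ξ` to `b` divides the
`n`-th coefficient by `P 0 ⋯ P (n - 1)`, where `P s = ∏ᵢ (s + bᵢ) / ∏ᵢ (s + ξᵢ)`.

Expanding the numerator in the Newton basis at the nodes `-ξᵢ`, with `ξ` in ascending order, gives
`P s = 1 + ∑ₖ Cₖ / ∏_{i ≥ k} (s + ξᵢ)`, and `C ≥ 0` when `b` lies in the polyhedron. Dividing the
`n`-th coefficient of `F` by `n + β` replaces `F t` by the average `∫₀¹ u ^ (β - 1) F (u t) du`, so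
multiplication by shifts of `P` preserves nonnegative series; as `P` decreases to `1`, a limit of
such multiplications is the division by `P 0 ⋯ P (n - 1)`. If `b` is not a rearrangement of `ξ`,
some `Cₖ` is positive, and the averaging makes the inequality strict.

The polyhedron is the set of vectors weakly supermajorized by `ξ`: a hyperplane separating such a
vector from it is excluded by Abel summation.
-/

section PowerSeries

open Filter Finset Topology

theorem summable_mul_pow_of_abs_le {c d : ℕ → ℝ} (hc : ∀ t : ℝ, Summable fun n => c n * t ^ n)
    (h : ∀ n, |d n| ≤ |c n|) (t : ℝ) : Summable fun n => d n * t ^ n :=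
  .of_norm_bounded (hc t).abs fun n => by
    rw [Real.norm_eq_abs, abs_mul, abs_mul]
    exact mul_le_mul_of_nonneg_right (h n) (abs_nonneg _)

theorem continuous_tsum_mul_pow {c : ℕ → ℝ} (hc : ∀ t : ℝ, Summable fun n => c n * t ^ n) :
    Continuous fun t : ℝ => ∑' n, c n * t ^ n := by
  refine continuous_iff_continuousAt.2 fun x => ?_
  have hcont : ContinuousOn (fun t : ℝ => ∑' n, c n * t ^ n) (Metric.ball 0 (|x| + 1)) := by
    refine continuousOn_tsum (fun n => by fun_prop) (hc (|x| + 1)).abs fun n t ht => ?_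
    rw [mem_ball_zero_iff, Real.norm_eq_abs] at ht
    rw [Real.norm_eq_abs, abs_mul, abs_mul, abs_pow, abs_pow,
      abs_of_pos (by positivity : 0 < |x| + 1)]
    gcongr
  exact hcont.continuousAt (Metric.isOpen_ball.mem_nhds (by simp))

theorem integral_rpow_mul_mul_pow {β : ℝ} (hβ : 0 < β) (a t : ℝ) (n : ℕ) :
    ∫ u in (0 : ℝ)..1, u ^ (β - 1) * (a * (u * t) ^ n) = a / (n + β) * t ^ n := by
  have hn : (0 : ℝ) < n + β := by positivity
  calc ∫ u in (0 : ℝ)..1, u ^ (β - 1) * (a * (u * t) ^ n)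
      = ∫ u in (0 : ℝ)..1, (a * t ^ n) * u ^ (n + β - 1) := by
        refine intervalIntegral.integral_congr_ae (Eventually.of_forall fun u hu => ?_)
        rw [Set.uIoc_of_le zero_le_one] at hu
        rw [show (n : ℝ) + β - 1 = (β - 1) + n by ring, Real.rpow_add hu.1, Real.rpow_natCast,
          mul_pow]
        ring
    _ = a / (n + β) * t ^ n := by
        rw [intervalIntegral.integral_const_mul, integral_rpow (Or.inl (by linarith)),
          sub_add_cancel, Real.one_rpow, Real.zero_rpow hn.ne']
        ring

theorem tsum_div_add_eq_integral {c : ℕ → ℝ} (hc : ∀ t : ℝ, Summable fun n => c n * t ^ n)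
    {β : ℝ} (hβ : 0 < β) (t : ℝ) :
    ∑' n : ℕ, c n / (n + β) * t ^ n =
      ∫ u in (0 : ℝ)..1, u ^ (β - 1) * ∑' n, c n * (u * t) ^ n := by
  simp only [← integral_rpow_mul_mul_pow hβ]
  refine (intervalIntegral.hasSum_integral_of_dominated_convergence
    (fun n u => u ^ (β - 1) * |c n * t ^ n|) (fun n => ?_) (fun n => ?_) ?_ ?_ ?_).tsum_eq
  · exact Measurable.aestronglyMeasurable (by fun_prop)
  · refine Eventually.of_forall fun u hu => ?_
    rw [Set.uIoc_of_le zero_le_one] at hu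
    have hu0 := hu.1.le
    rw [Real.norm_eq_abs, mul_pow, mul_left_comm (c n), abs_mul, abs_mul (u ^ n),
      abs_of_nonneg (Real.rpow_nonneg hu0 _), abs_of_nonneg (pow_nonneg hu0 n)]
    gcongr
    exact mul_le_of_le_one_left (abs_nonneg _) (pow_le_one₀ hu0 hu.2)
  · exact Eventually.of_forall fun u _ => (hc t).abs.mul_left _
  · simp only [tsum_mul_left]
    exact (intervalIntegral.intervalIntegrable_rpow' (by linarith)).mul_const _
  · exact Eventually.of_forall fun u _ => (hc (u * t)).hasSum.mul_left _

theorem integral_rpow_mul_pos {F : ℝ → ℝ} {β : ℝ} (hβ : 0 < β) (hF : Continuous F)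
    (hF_nonneg : ∀ u, 0 ≤ u → 0 ≤ F u) (hF_zero : 0 < F 0) :
    0 < ∫ u in (0 : ℝ)..1, u ^ (β - 1) * F u := by
  obtain ⟨δ, hδ, hδF⟩ := (mem_nhdsGT_iff_exists_mem_Ioc_Ioo_subset (zero_lt_one' ℝ)).1
    (mem_nhdsWithin_of_mem_nhds (hF.continuousAt.eventually (lt_mem_nhds hF_zero)))
  have hint (a b : ℝ) :
      IntervalIntegrable (fun u => u ^ (β - 1) * F u) MeasureTheory.volume a b :=
    (intervalIntegral.intervalIntegrable_rpow' (by linarith)).mul_continuousOn hF.continuousOn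
  rw [← intervalIntegral.integral_add_adjacent_intervals (hint 0 δ) (hint δ 1)]
  refine add_pos_of_pos_of_nonneg ?_ ?_
  · exact intervalIntegral.intervalIntegral_pos_of_pos_on (hint 0 δ)
      (fun u hu => mul_pos (Real.rpow_pos_of_pos hu.1 _) (hδF hu)) hδ.1
  · refine intervalIntegral.integral_nonneg hδ.2 fun u hu => ?_
    have hu0 : 0 ≤ u := hδ.1.le.trans hu.1
    exact mul_nonneg (Real.rpow_nonneg hu0 _) (hF_nonneg u hu0)

/-- `c` is the coefficient sequence of an entire power series that is nonnegative on `[0, ∞)`.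
Since `₂F₃` is evaluated at `-x²`, the alternating signs are absorbed into `c`. -/
structure NonnegSeries (c : ℕ → ℝ) : Prop where
  summable : ∀ t : ℝ, Summable fun n => c n * t ^ n
  nonneg : ∀ t : ℝ, 0 ≤ t → 0 ≤ ∑' n, c n * t ^ n

namespace NonnegSeries

variable {c : ℕ → ℝ}

theorem const_mul (hc : NonnegSeries c) {a : ℝ} (ha : 0 ≤ a) :
    NonnegSeries fun n => a * c n where
  summable t := by simpa only [mul_assoc] using (hc.summable t).mul_left a
  nonneg t ht := by
    simp only [mul_assoc, tsum_mul_left]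
    exact mul_nonneg ha (hc.nonneg t ht)

theorem of_tendsto {d : ℕ → ℕ → ℝ} {e : ℕ → ℝ} (hc : ∀ t : ℝ, Summable fun n => c n * t ^ n)
    (hd : ∀ K, NonnegSeries (d K)) (hdc : ∀ K n, |d K n| ≤ |c n|)
    (hde : ∀ n, Tendsto (fun K => d K n) atTop (𝓝 (e n))) : NonnegSeries e where
  summable :=
    summable_mul_pow_of_abs_le hc fun n => le_of_tendsto' (hde n).abs fun K => hdc K n
  nonneg t ht := by
    have hlim : Tendsto (fun K => ∑' n, d K n * t ^ n) atTop (𝓝 (∑' n, e n * t ^ n)) := by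
      refine tendsto_tsum_of_dominated_convergence (hc t).abs (fun n => (hde n).mul_const _)
        (Eventually.of_forall fun K n => ?_)
      rw [Real.norm_eq_abs, abs_mul, abs_mul]
      exact mul_le_mul_of_nonneg_right (hdc K n) (abs_nonneg _)
    exact ge_of_tendsto' hlim fun K => (hd K).nonneg t ht

theorem div_add (hc : NonnegSeries c) {β : ℝ} (hβ : 0 < β) :
    NonnegSeries fun n => c n / (n + β) where
  summable := by
    have hβc (t : ℝ) : Summable fun n => β⁻¹ * c n * t ^ n := by
      simpa only [mul_assoc] using (hc.summable t).mul_left β⁻¹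
    refine summable_mul_pow_of_abs_le hβc fun n => ?_
    have hn : (0 : ℝ) < n + β := by positivity
    rw [abs_div, abs_mul, abs_inv, abs_of_pos hβ, abs_of_pos hn, div_eq_inv_mul]
    gcongr
    exact le_add_of_nonneg_left n.cast_nonneg
  nonneg t ht := by
    rw [tsum_div_add_eq_integral hc.summable hβ t]
    exact intervalIntegral.integral_nonneg zero_le_one fun u hu =>
      mul_nonneg (Real.rpow_nonneg hu.1 _) (hc.nonneg _ (mul_nonneg hu.1 ht))

theorem tsum_div_add_pos (hc : NonnegSeries c) (hc0 : 0 < c 0) {β t : ℝ} (hβ : 0 < β)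
    (ht : 0 ≤ t) : 0 < ∑' n : ℕ, c n / (n + β) * t ^ n := by
  rw [tsum_div_add_eq_integral hc.summable hβ t]
  refine integral_rpow_mul_pos hβ ((continuous_tsum_mul_pow hc.summable).comp (by fun_prop))
    (fun u hu => hc.nonneg _ (mul_nonneg hu ht)) ?_
  rw [zero_mul, tsum_eq_single 0 fun n hn => by simp [hn]]
  simpa using hc0

variable {ι : Type*} {β : ι → ℝ}

theorem div_prod_add (hc : NonnegSeries c) (hβ : ∀ i, 0 < β i) (s : Finset ι) :
    NonnegSeries fun n => c n / ∏ i ∈ s, (n + β i) := by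
  induction s using Finset.cons_induction with
  | empty => simpa using hc
  | cons i s _ ih =>
    simpa only [prod_cons, mul_comm (_ + β i), ← div_div] using ih.div_add (hβ i)

theorem tsum_div_prod_add_pos (hc : NonnegSeries c) (hc0 : 0 < c 0) (hβ : ∀ i, 0 < β i)
    {s : Finset ι} (hs : s.Nonempty) {t : ℝ} (ht : 0 ≤ t) :
    0 < ∑' n : ℕ, c n / (∏ i ∈ s, (n + β i)) * t ^ n := by
  classical
  obtain ⟨i, hi⟩ := hs
  have hc0' : 0 < c 0 / ∏ j ∈ s.erase i, (((0 : ℕ) : ℝ) + β j) :=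
    div_pos hc0 (prod_pos fun j _ => by simpa using hβ j)
  simpa only [div_div, prod_erase_mul _ _ hi] using
    (hc.div_prod_add hβ (s.erase i)).tsum_div_add_pos hc0' (hβ i) ht

end NonnegSeries

/-- A sequence decreasing to `1`, every shift of which maps nonnegative entire series to
nonnegative entire series by termwise multiplication. The point of the notion is that one may then
also *divide* by the products `P 0 ⋯ P (n - 1)`. -/
structure IsShiftMultiplier (P : ℕ → ℝ) : Prop where
  one_le : ∀ n, 1 ≤ P n
  antitone : Antitone P
  tendsto_one : Tendsto P atTop (𝓝 1)
  mul_shift : ∀ {c : ℕ → ℝ}, NonnegSeries c → ∀ k, NonnegSeries fun n => c n * P (n + k)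

namespace IsShiftMultiplier

variable {P : ℕ → ℝ}

theorem pos (hP : IsShiftMultiplier P) (n : ℕ) : 0 < P n :=
  one_pos.trans_le (hP.one_le n)

theorem prod_range_pos (hP : IsShiftMultiplier P) (n : ℕ) : 0 < ∏ j ∈ range n, P j :=
  prod_pos fun j _ => hP.pos j

theorem shift (hP : IsShiftMultiplier P) (k : ℕ) : IsShiftMultiplier fun n => P (n + k) where
  one_le n := hP.one_le _
  antitone _ _ hmn := hP.antitone (Nat.add_le_add_right hmn k)
  tendsto_one := hP.tendsto_one.comp (tendsto_add_atTop_nat k)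
  mul_shift hc l := by simpa only [add_assoc] using hP.mul_shift hc (l + k)

theorem mul_prod_shift (hP : IsShiftMultiplier P) {c : ℕ → ℝ} (hc : NonnegSeries c) (K : ℕ) :
    NonnegSeries fun n => c n * ∏ k ∈ range K, P (n + k) := by
  induction K with
  | zero => simpa using hc
  | succ K ih => simpa only [prod_range_succ, mul_assoc] using hP.mul_shift ih K

end IsShiftMultiplier

namespace NonnegSeries

variable {P c : ℕ → ℝ}

-- `c n / (P 0 ⋯ P (n - 1))` is the limit, as `K → ∞`, of
-- `c n * P K ⋯ P (K + n - 1) / (P 0 ⋯ P (n - 1)) = c n * P n ⋯ P (n + K - 1) / (P 0 ⋯ P (K - 1))`.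
theorem div_prod_range (hc : NonnegSeries c) (hP : IsShiftMultiplier P) :
    NonnegSeries fun n => c n / ∏ j ∈ range n, P j := by
  have hratio (K n : ℕ) : (∏ k ∈ range K, P k)⁻¹ * (c n * ∏ k ∈ range K, P (n + k)) =
      c n * ((∏ j ∈ range n, P (K + j)) / ∏ j ∈ range n, P j) := by
    have hswap : (∏ j ∈ range n, P j) * ∏ k ∈ range K, P (n + k) =
        (∏ k ∈ range K, P k) * ∏ j ∈ range n, P (K + j) := by
      rw [← prod_range_add, ← prod_range_add, add_comm]
    rw [inv_mul_eq_div, ← mul_div_assoc,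
      div_eq_div_iff (hP.prod_range_pos K).ne' (hP.prod_range_pos n).ne']
    linear_combination c n * hswap
  refine of_tendsto hc.summable
    (fun K => (hP.mul_prod_shift hc K).const_mul (inv_nonneg.2 (hP.prod_range_pos K).le))
    (fun K n => ?_) (fun n => ?_)
  · have hratio_nonneg : 0 ≤ (∏ j ∈ range n, P (K + j)) / ∏ j ∈ range n, P j :=
      div_nonneg (prod_nonneg fun j _ => (hP.pos _).le) (hP.prod_range_pos n).le
    have hratio_le_one : (∏ j ∈ range n, P (K + j)) / ∏ j ∈ range n, P j ≤ 1 :=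
      div_le_one_of_le₀ (prod_le_prod (fun j _ => (hP.pos _).le)
        fun j _ => hP.antitone (Nat.le_add_left j K)) (hP.prod_range_pos n).le
    rw [hratio, abs_mul, abs_of_nonneg hratio_nonneg]
    exact mul_le_of_le_one_right (abs_nonneg _) hratio_le_one
  · have hone : Tendsto (fun K => ∏ j ∈ range n, P (K + j)) atTop (𝓝 1) := by
      simpa using tendsto_finsetProd (range n) fun j _ =>
        hP.tendsto_one.comp (tendsto_add_atTop_nat j)
    simpa only [hratio, mul_one_div] using
      (hone.div_const (∏ j ∈ range n, P j)).const_mul (c n)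

-- `P 0 ⋯ P (n - 1) * P n = P 0 * (P 1 ⋯ P n)`, so that the division by the products of `P` is,
-- up to the factor `P 0`, a multiplication by `P` after the division by the products of its shift.
theorem tsum_div_prod_range_pos (hc : NonnegSeries c) (hP : IsShiftMultiplier P) (hc0 : 0 < c 0)
    {t : ℝ}
    (hmul : ∀ d : ℕ → ℝ, NonnegSeries d → 0 < d 0 → 0 < ∑' n, d n * P n * t ^ n) :
    0 < ∑' n, c n / (∏ j ∈ range n, P j) * t ^ n := by
  have hterm (n : ℕ) : c n / (∏ j ∈ range n, P j) * t ^ n =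
      (P 0)⁻¹ * (c n / (∏ j ∈ range n, P (j + 1)) * P n * t ^ n) := by
    have hprod : (∏ j ∈ range n, P (j + 1)) * P 0 = (∏ j ∈ range n, P j) * P n := by
      rw [← prod_range_succ', prod_range_succ]
    have h0 := (hP.pos 0).ne'
    have hn := (hP.prod_range_pos n).ne'
    have hn' := ((hP.shift 1).prod_range_pos n).ne'
    field_simp
    linear_combination c n * t ^ n * hprod
  simp only [hterm, tsum_mul_left]
  exact mul_pos (inv_pos.2 (hP.pos 0))
    (hmul _ (hc.div_prod_range (hP.shift 1)) (by simpa using hc0))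

end NonnegSeries

section newtonRatio

variable {ι : Type*} [Fintype ι] [Preorder ι] [LocallyFiniteOrderTop ι]

/-- The rational function `1 + ∑ₖ Cₖ / ∏_{i ≥ k} (s + ξᵢ)`. Multiplied by `∏ᵢ (s + ξᵢ)`, for
linearly ordered indices, it is the monic polynomial with coefficients `C` in the Newton basis
at the nodes `-ξ`. -/
noncomputable def newtonRatio (C ξ : ι → ℝ) (s : ℝ) : ℝ :=
  1 + ∑ k, C k / ∏ i ∈ Ici k, (s + ξ i)

variable {C ξ : ι → ℝ}

theorem newtonRatio_add (C ξ : ι → ℝ) (s t : ℝ) :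
    newtonRatio C ξ (s + t) = newtonRatio C (fun i => t + ξ i) s := by
  simp only [newtonRatio, add_assoc]

theorem one_le_newtonRatio (hC : 0 ≤ C) (hξ : ∀ i, 0 < ξ i) {s : ℝ} (hs : 0 ≤ s) :
    1 ≤ newtonRatio C ξ s :=
  le_add_of_nonneg_right <| sum_nonneg fun k _ =>
    div_nonneg (hC k) (prod_nonneg fun i _ => (add_pos_of_nonneg_of_pos hs (hξ i)).le)

theorem antitoneOn_newtonRatio (hC : 0 ≤ C) (hξ : ∀ i, 0 < ξ i) :
    AntitoneOn (newtonRatio C ξ) (Set.Ici 0) := by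
  intro s hs t _ hst
  have hs_pos (i : ι) : 0 < s + ξ i := add_pos_of_nonneg_of_pos hs (hξ i)
  unfold newtonRatio
  gcongr with k _ i
  · exact hC k
  · exact prod_pos fun i _ => hs_pos i
  · exact fun i _ => (hs_pos i).le

theorem tendsto_prod_add_atTop {κ : Type*} {s : Finset κ} (hs : s.Nonempty) (ξ : κ → ℝ) :
    Tendsto (fun x : ℝ => ∏ i ∈ s, (x + ξ i)) atTop atTop := by
  have hfactor (i : κ) : Tendsto (fun x : ℝ => x + ξ i) atTop atTop :=
    tendsto_atTop_add_const_right _ _ tendsto_id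
  induction hs using Nonempty.cons_induction with
  | singleton i => simpa only [prod_singleton] using hfactor i
  | cons i s _ _ ih => simpa only [prod_cons] using (hfactor i).atTop_mul_atTop₀ ih

theorem tendsto_newtonRatio_atTop (C ξ : ι → ℝ) : Tendsto (newtonRatio C ξ) atTop (𝓝 1) := by
  have hterm (k : ι) : Tendsto (fun s => C k / ∏ i ∈ Ici k, (s + ξ i)) atTop (𝓝 0) :=
    (tendsto_prod_add_atTop nonempty_Ici ξ).const_div_atTop (C k)
  unfold newtonRatio
  simpa only [sum_const_zero, add_zero] using
    (tendsto_finsetSum univ fun k _ => hterm k).const_add 1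

end newtonRatio

namespace NonnegSeries

variable {ι : Type*} [Fintype ι] [Preorder ι] [LocallyFiniteOrderTop ι] {C ξ : ι → ℝ} {c : ℕ → ℝ}

theorem hasSum_mul_newtonRatio (hc : NonnegSeries c) (C : ι → ℝ) (hξ : ∀ i, 0 < ξ i) (t : ℝ) :
    HasSum (fun n : ℕ => c n * newtonRatio C ξ n * t ^ n)
      (∑' n, c n * t ^ n + ∑ k, C k * ∑' n : ℕ, c n / (∏ i ∈ Ici k, (n + ξ i)) * t ^ n) := by
  have hsum := (hc.summable t).hasSum.add <| hasSum_sum fun k (_ : k ∈ univ) =>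
    ((hc.div_prod_add hξ (Ici k)).summable t).hasSum.mul_left (C k)
  refine hsum.congr_fun fun n => ?_
  simp only [newtonRatio, mul_add, add_mul, mul_one, mul_sum, sum_mul]
  congr 1
  exact sum_congr rfl fun k _ => by ring

theorem mul_newtonRatio (hc : NonnegSeries c) (hC : 0 ≤ C) (hξ : ∀ i, 0 < ξ i) :
    NonnegSeries fun n => c n * newtonRatio C ξ n where
  summable t := (hc.hasSum_mul_newtonRatio C hξ t).summable
  nonneg t ht := by
    rw [(hc.hasSum_mul_newtonRatio C hξ t).tsum_eq]
    exact add_nonneg (hc.nonneg t ht) <| sum_nonneg fun k _ =>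
      mul_nonneg (hC k) ((hc.div_prod_add hξ _).nonneg t ht)

theorem tsum_mul_newtonRatio_pos (hc : NonnegSeries c) (hc0 : 0 < c 0) (hC : 0 < C)
    (hξ : ∀ i, 0 < ξ i) {t : ℝ} (ht : 0 ≤ t) :
    0 < ∑' n : ℕ, c n * newtonRatio C ξ n * t ^ n := by
  obtain ⟨hC_nonneg, k, hk⟩ := Pi.lt_def.1 hC
  have hpos (j : ι) := hc.tsum_div_prod_add_pos hc0 hξ (nonempty_Ici (a := j)) ht
  rw [(hc.hasSum_mul_newtonRatio C hξ t).tsum_eq]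
  exact add_pos_of_nonneg_of_pos (hc.nonneg t ht) <| sum_pos'
    (fun j _ => mul_nonneg (hC_nonneg j) (hpos j).le) ⟨k, mem_univ k, mul_pos hk (hpos k)⟩

end NonnegSeries

theorem isShiftMultiplier_newtonRatio {ι : Type*} [Fintype ι] [Preorder ι]
    [LocallyFiniteOrderTop ι] {C ξ : ι → ℝ} (hC : 0 ≤ C) (hξ : ∀ i, 0 < ξ i) :
    IsShiftMultiplier fun n => newtonRatio C ξ n where
  one_le n := one_le_newtonRatio hC hξ n.cast_nonneg
  antitone m n hmn :=
    antitoneOn_newtonRatio hC hξ (Set.mem_Ici.2 m.cast_nonneg) (Set.mem_Ici.2 n.cast_nonneg)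
      (Nat.cast_le.2 hmn)
  tendsto_one := (tendsto_newtonRatio_atTop C ξ).comp tendsto_natCast_atTop_atTop
  mul_shift hc k := by
    simpa only [Nat.cast_add, newtonRatio_add] using
      hc.mul_newtonRatio hC fun i => add_pos_of_nonneg_of_pos k.cast_nonneg (hξ i)

end PowerSeries

section Majorization

open Finset
open scoped Pointwise

theorem mul_sum_le_sum_mul_of_antitoneOn {ι : Type*} [LinearOrder ι] {w d : ι → ℝ} {c : ℝ}
    (s : Finset ι) (hw : AntitoneOn w s) (hcw : ∀ i ∈ s, c ≤ w i)
    (hd : ∀ k ∈ s, 0 ≤ ∑ i ∈ s with i ≤ k, d i) : c * ∑ i ∈ s, d i ≤ ∑ i ∈ s, w i * d i := by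
  induction s using Finset.induction_on_max generalizing c with
  | empty => simp
  | insert a s ha ih =>
    have has : a ∉ s := fun h => lt_irrefl a (ha a h)
    have hfilter_self : (insert a s).filter (· ≤ a) = insert a s :=
      filter_true_of_mem fun i hi => (mem_insert.1 hi).elim le_of_eq fun h => (ha i h).le
    have hfilter {k : ι} (hk : k ∈ s) : (insert a s).filter (· ≤ k) = s.filter (· ≤ k) := by
      rw [filter_insert, if_neg (ha k hk).not_ge]
    have hsum_nonneg : 0 ≤ ∑ i ∈ insert a s, d i := by
      simpa only [hfilter_self] using hd a (mem_insert_self a s)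
    calc c * ∑ i ∈ insert a s, d i
        ≤ w a * ∑ i ∈ insert a s, d i := by
          gcongr
          exact hcw a (mem_insert_self a s)
      _ = w a * d a + w a * ∑ i ∈ s, d i := by rw [sum_insert has, mul_add]
      _ ≤ w a * d a + ∑ i ∈ s, w i * d i := by
          gcongr
          refine ih (hw.mono fun i hi => mem_insert_of_mem hi) (fun i hi => ?_) fun k hk => ?_
          · exact hw (mem_insert_of_mem hi) (mem_insert_self a s) (ha i hi).le
          · simpa only [hfilter hk] using hd k (mem_insert_of_mem hk)
      _ = ∑ i ∈ insert a s, w i * d i := by rw [sum_insert has]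

variable {n : ℕ}

/-- Weak supermajorization of vectors, for `ξ` arranged in ascending order: any `k` entries of `b`
add up to at least the sum of the `k` smallest entries of `ξ`. The sets of `k` entries are
enumerated, redundantly, as the initial segments of the rearrangements of `b`. These inequalities
describe the Newton polyhedron. -/
def WeaklySupermajorizedBy (b ξ : Fin n → ℝ) : Prop :=
  ∀ (σ : Equiv.Perm (Fin n)) (k : Fin n), ∑ i ∈ Iic k, ξ i ≤ ∑ i ∈ Iic k, b (σ i)

namespace WeaklySupermajorizedBy

variable {b b' ξ : Fin n → ℝ}

theorem mono (h : WeaklySupermajorizedBy b ξ) (hb : b ≤ b') : WeaklySupermajorizedBy b' ξ :=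
  fun σ k => (h σ k).trans (sum_le_sum fun i _ => hb (σ i))

theorem le_apply [NeZero n] (h : WeaklySupermajorizedBy b ξ) (i : Fin n) : ξ 0 ≤ b i := by
  have hIic : Iic (0 : Fin n) = {0} := by ext; simp
  simpa [hIic] using h (Equiv.swap 0 i) 0

theorem comp_perm_self (hξ : Monotone ξ) (τ : Equiv.Perm (Fin n)) :
    WeaklySupermajorizedBy (ξ ∘ τ) ξ := by
  intro σ k
  have hanti : Antitone fun i => if i ≤ k then (1 : ℝ) else 0 := by
    intro i j hij
    dsimp only
    split_ifs with hj hi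
    exacts [le_rfl, absurd (hij.trans hj) hi, zero_le_one, le_rfl]
  have hsum (f : Fin n → ℝ) : ∑ i, (if i ≤ k then (1 : ℝ) else 0) * f i = ∑ i ∈ Iic k, f i := by
    simp [← sum_filter, filter_ge_eq_Iic]
  simpa only [hsum, Function.comp_apply, Equiv.Perm.mul_apply] using
    (hanti.antivary hξ).sum_mul_le_sum_mul_comp_perm (σ := τ * σ)

theorem convex_setOf (ξ : Fin n → ℝ) : Convex ℝ {b | WeaklySupermajorizedBy b ξ} := by
  simp only [WeaklySupermajorizedBy, Set.ofPred_forall]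
  exact convex_iInter fun σ => convex_iInter fun k => convex_halfSpace_ge
    ⟨fun _ _ => sum_add_distrib, fun _ _ => (mul_sum _ _ _).symm⟩ _

theorem exists_perm_sum_mul_le (h : WeaklySupermajorizedBy b ξ) {w : Fin n → ℝ} (hw : 0 ≤ w) :
    ∃ τ : Equiv.Perm (Fin n), ∑ i, w i * ξ (τ i) ≤ ∑ i, w i * b i := by
  set σ := Tuple.sort (-w)
  have hanti : Antitone (w ∘ σ) := fun i j hij => by
    simpa using Tuple.monotone_sort (-w) hij
  refine ⟨σ⁻¹, ?_⟩
  have hsum := mul_sum_le_sum_mul_of_antitoneOn (d := fun i => b (σ i) - ξ i) (c := 0) univ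
    (hanti.antitoneOn _) (fun i _ => hw (σ i)) fun k _ => by
      simpa [filter_ge_eq_Iic] using h σ k
  rw [← Equiv.sum_comp σ, ← Equiv.sum_comp σ fun i => w i * b i]
  simpa [mul_sub] using hsum

end WeaklySupermajorizedBy

theorem nonneg_of_forall_lt_add_mul {𝕜 : Type*} [Field 𝕜] [LinearOrder 𝕜] [IsStrictOrderedRing 𝕜]
    {u a m : 𝕜} (h : ∀ r, 0 ≤ r → u < a + r * m) : 0 ≤ m := by
  by_contra! hm
  have hua : u < a := by simpa only [zero_mul, add_zero] using h 0 le_rfl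
  have hlt := h ((u - a) / m) (div_nonneg_of_nonpos (sub_nonpos.2 hua.le) hm.le)
  rw [div_mul_cancel₀ _ hm.ne, add_sub_cancel] at hlt
  exact hlt.false

/- Rado's theorem. For a separating hyperplane with normal `w`, the orthant directions force
`w ≥ 0`, and then some rearrangement of `ξ` is on the wrong side of it. -/
theorem mem_convexHull_range_comp_perm_add_Ici_iff {b ξ : Fin n → ℝ} (hξ : Monotone ξ) :
    b ∈ convexHull ℝ (Set.range fun σ : Equiv.Perm (Fin n) => ξ ∘ σ) + Set.Ici 0 ↔
      WeaklySupermajorizedBy b ξ := by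
  set K := convexHull ℝ (Set.range fun σ : Equiv.Perm (Fin n) => ξ ∘ σ)
  constructor
  · rintro ⟨v, hv, p, hp, rfl⟩
    have hK : K ⊆ {b | WeaklySupermajorizedBy b ξ} := convexHull_min
      (Set.range_subset_iff.2 fun τ => .comp_perm_self hξ τ) (.convex_setOf ξ)
    exact (hK hv).mono (le_add_of_nonneg_right hp)
  · intro hb
    by_contra hmem
    have hconv : Convex ℝ (K + Set.Ici 0) :=
      (convex_convexHull ℝ _).add (convex_Ici (0 : Fin n → ℝ))
    have hclosed : IsClosed (K + Set.Ici 0) :=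
      isClosed_Ici.add_left_of_isCompact ((Set.finite_range _).isCompact_convexHull ℝ)
    obtain ⟨f, u, hfb, hf⟩ := geometric_hahn_banach_point_closed hconv hclosed hmem
    have hf_eq (x : Fin n → ℝ) : f x = ∑ i, f (Pi.single i 1) * x i := by
      conv_lhs => rw [← univ_sum_single x, map_sum]
      refine sum_congr rfl fun i _ => ?_
      rw [← mul_one (x i), ← smul_eq_mul, Pi.single_smul, map_smul, smul_eq_mul, smul_eq_mul,
        mul_one, mul_comm]
    have hvertex (τ : Equiv.Perm (Fin n)) : ξ ∘ τ ∈ K :=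
      subset_convexHull ℝ _ (Set.mem_range_self τ)
    have hw : 0 ≤ fun i => f (Pi.single i 1) := fun i =>
      nonneg_of_forall_lt_add_mul (u := u) (a := f (ξ ∘ (1 : Equiv.Perm (Fin n)))) fun r hr => by
        have hdir : r • (Pi.single i 1 : Fin n → ℝ) ∈ Set.Ici 0 :=
          Set.mem_Ici.2 (smul_nonneg hr (Pi.single_nonneg.2 zero_le_one))
        simpa only [map_add, map_smul, smul_eq_mul] using hf _ (Set.add_mem_add (hvertex 1) hdir)
    obtain ⟨τ, hτ⟩ := hb.exists_perm_sum_mul_le hw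
    have hlt : u < f (ξ ∘ τ) := by
      simpa only [add_zero] using hf _ (Set.add_mem_add (hvertex τ) Set.self_mem_Ici)
    refine (hfb.trans hlt).not_ge ?_
    rw [hf_eq b, hf_eq (ξ ∘ τ)]
    exact hτ

theorem newtonPolyhedron_eq_convexHull_add_Ici (E : Set (Fin 3 → ℝ)) :
    newtonPolyhedron E = convexHull ℝ E + Set.Ici 0 := by
  have hunion : ⋃ x ∈ E, Set.Ici x = E + Set.Ici 0 := by
    rw [← Set.iUnion_add_left_image]
    simp only [Set.image_const_add_Ici, add_zero]
  rw [newtonPolyhedron, hunion, convexHull_add, (convex_Ici (0 : Fin 3 → ℝ)).convexHull_eq]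

theorem weaklySupermajorizedBy_fin_three_iff {b ξ : Fin 3 → ℝ} :
    WeaklySupermajorizedBy b ξ ↔
      (ξ 0 ≤ b 0 ∧ ξ 0 ≤ b 1 ∧ ξ 0 ≤ b 2) ∧
      (ξ 0 + ξ 1 ≤ b 0 + b 1 ∧ ξ 0 + ξ 1 ≤ b 1 + b 2 ∧ ξ 0 + ξ 1 ≤ b 0 + b 2) ∧
      ξ 0 + ξ 1 + ξ 2 ≤ b 0 + b 1 + b 2 := by
  have h0 : Iic (0 : Fin 3) = {0} := rfl
  have h1 : Iic (1 : Fin 3) = {0, 1} := rfl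
  have h2 : Iic (2 : Fin 3) = univ := rfl
  constructor
  · intro h
    have hpair (σ : Equiv.Perm (Fin 3)) : ξ 0 + ξ 1 ≤ b (σ 0) + b (σ 1) := by
      simpa [h1] using h σ 1
    have htotal : ξ 0 + ξ 1 + ξ 2 ≤ b 0 + b 1 + b 2 := by
      simpa [h2, Fin.sum_univ_three] using h 1 2
    exact ⟨⟨h.le_apply 0, h.le_apply 1, h.le_apply 2⟩,
      ⟨hpair 1, (hpair (Equiv.swap 0 2)).trans_eq (add_comm _ _), hpair (Equiv.swap 1 2)⟩, htotal⟩
  · rintro ⟨⟨hb0, hb1, hb2⟩, ⟨hb01, hb12, hb02⟩, htotal⟩ σ k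
    have hmin (i : Fin 3) : ξ 0 ≤ b i := by fin_cases i <;> assumption
    have hpair {i j : Fin 3} (hij : i ≠ j) : ξ 0 + ξ 1 ≤ b i + b j := by
      fin_cases i <;> fin_cases j <;> grind
    fin_cases k
    · simpa [h0] using hmin (σ 0)
    · simpa [h1] using hpair (σ.injective.ne zero_ne_one)
    · simpa [h2, Equiv.sum_comp σ b, Fin.sum_univ_three] using htotal

theorem xi_monotone (a₁ a₂ : ℝ) : Monotone (xi a₁ a₂) := Tuple.monotone_sort _

theorem vertexSet_eq_range_xi_comp (a₁ a₂ : ℝ) :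
    vertexSet a₁ a₂ = Set.range fun σ : Equiv.Perm (Fin 3) => xi a₁ a₂ ∘ σ :=
  ((Equiv.mulLeft (Tuple.sort (basePoint a₁ a₂))).surjective.range_comp
    fun σ : Equiv.Perm (Fin 3) => basePoint a₁ a₂ ∘ σ).symm

theorem mem_newtonPolyhedron_vertexSet_iff {a₁ a₂ : ℝ} {b : Fin 3 → ℝ} :
    b ∈ newtonPolyhedron (vertexSet a₁ a₂) ↔ WeaklySupermajorizedBy b (xi a₁ a₂) := by
  rw [newtonPolyhedron_eq_convexHull_add_Ici, vertexSet_eq_range_xi_comp,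
    mem_convexHull_range_comp_perm_add_Ici_iff (xi_monotone a₁ a₂)]

theorem sum_xi (a₁ a₂ : ℝ) : xi a₁ a₂ 0 + xi a₁ a₂ 1 + xi a₁ a₂ 2 = 3 * a₁ + a₂ + 1 / 2 := by
  have hsum := Equiv.sum_comp (Tuple.sort (basePoint a₁ a₂)) (basePoint a₁ a₂)
  simp only [Fin.sum_univ_three] at hsum
  refine hsum.trans ?_
  simp only [basePoint, Matrix.cons_val]
  ring

theorem xi_pos {a₁ a₂ : ℝ} (ha₁ : 0 < a₁) (ha₂ : 0 < a₂) (i : Fin 3) : 0 < xi a₁ a₂ i := by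
  have hpos (j : Fin 3) : 0 < basePoint a₁ a₂ j := by
    fin_cases j <;>
      simp only [basePoint, Fin.zero_eta, Fin.mk_one, Fin.reduceFinMk, Matrix.cons_val] <;>
      positivity
  exact hpos _

end Majorization

section NewtonCoefficients

open Finset

theorem exists_perm_of_map_univ_eq {ι α : Type*} [Fintype ι] {f g : ι → α}
    (h : univ.val.map f = univ.val.map g) : ∃ σ : Equiv.Perm ι, g ∘ σ = f := by
  classical
  have hcard (a : α) : Fintype.card {i // f i = a} = Fintype.card {i // g i = a} := by
    simpa [Multiset.count_map, Fintype.card_subtype, Finset.card_def, eq_comm] using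
      congrArg (Multiset.count a) h
  have e (a : α) : {i // f i = a} ≃ {i // g i = a} := Fintype.equivOfCardEq (hcard a)
  exact ⟨Equiv.ofFiberEquiv e, funext fun i => Equiv.ofFiberEquiv_map e i⟩

theorem exists_perm_of_forall_prod_add_eq {ι R : Type*} [Fintype ι] [CommRing R] [IsDomain R]
    [Infinite R] {b ξ : ι → R} (h : ∀ s, ∏ i, (s + b i) = ∏ i, (s + ξ i)) :
    ∃ σ : Equiv.Perm ι, ξ ∘ σ = b := by
  have hpoly : ∏ i, (Polynomial.X - Polynomial.C (-b i)) =
      ∏ i, (Polynomial.X - Polynomial.C (-ξ i)) :=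
    Polynomial.funext fun s => by simpa [Polynomial.eval_prod] using h s
  have hroots (f : ι → R) :
      (∏ i, (Polynomial.X - Polynomial.C (f i))).roots = univ.val.map f := by
    rw [← Polynomial.roots_multiset_prod_X_sub_C (univ.val.map f), Multiset.map_map]
    rfl
  obtain ⟨σ, hσ⟩ : ∃ σ : Equiv.Perm ι, (-ξ) ∘ σ = -b := by
    refine exists_perm_of_map_univ_eq ?_
    rw [← hroots, ← hroots]
    exact congrArg Polynomial.roots hpoly
  exact ⟨σ, neg_injective hσ⟩

/-- The coefficients of `∏ᵢ (s + bᵢ) - ∏ᵢ (s + ξᵢ)` in the Newton basis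
`1, s + ξ₀, (s + ξ₀) (s + ξ₁)`; with them `newtonRatio` is `∏ᵢ (s + bᵢ) / ∏ᵢ (s + ξᵢ)`. -/
def newtonCoeff (b ξ : Fin 3 → ℝ) : Fin 3 → ℝ :=
  ![∏ i, (b i - ξ 0), (b 0 - ξ 1) * (b 1 - ξ 1) + (b 2 - ξ 0) * (b 0 + b 1 - ξ 0 - ξ 1),
    ∑ i, b i - ∑ i, ξ i]

theorem prod_add_eq_newton (b ξ : Fin 3 → ℝ) (s : ℝ) :
    ∏ i, (s + b i) = ∏ i, (s + ξ i) + (newtonCoeff b ξ 0 + newtonCoeff b ξ 1 * (s + ξ 0) +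
      newtonCoeff b ξ 2 * ((s + ξ 0) * (s + ξ 1))) := by
  simp only [newtonCoeff, Fin.sum_univ_three, Fin.prod_univ_three, Matrix.cons_val]
  ring

theorem newtonRatio_newtonCoeff {b ξ : Fin 3 → ℝ} {s : ℝ} (hs : ∀ i, s + ξ i ≠ 0) :
    newtonRatio (newtonCoeff b ξ) ξ s = (∏ i, (s + b i)) / ∏ i, (s + ξ i) := by
  have h0 : Ici (0 : Fin 3) = univ := rfl
  have h1 : Ici (1 : Fin 3) = {1, 2} := rfl
  have h2 : Ici (2 : Fin 3) = {2} := rfl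
  have hs0 := hs 0
  have hs1 := hs 1
  have hs2 := hs 2
  rw [newtonRatio, prod_add_eq_newton b ξ s, Fin.sum_univ_three, h0, h1, h2, Fin.prod_univ_three,
    prod_pair (by decide), prod_singleton]
  field_simp

theorem exists_perm_of_newtonCoeff_eq_zero {b ξ : Fin 3 → ℝ} (h : newtonCoeff b ξ = 0) :
    ∃ σ : Equiv.Perm (Fin 3), ξ ∘ σ = b :=
  exists_perm_of_forall_prod_add_eq fun s => by simp [prod_add_eq_newton b ξ s, h]

theorem mul_nonneg_or_mul_nonneg_or_mul_nonneg {R : Type*} [Ring R] [LinearOrder R]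
    [IsOrderedRing R] (x y z : R) : 0 ≤ x * y ∨ 0 ≤ y * z ∨ 0 ≤ x * z := by
  rcases le_total 0 x with hx | hx <;> rcases le_total 0 y with hy | hy <;>
    rcases le_total 0 z with hz | hz <;>
    simp [mul_nonneg, mul_nonneg_of_nonpos_of_nonpos, *]

theorem newtonCoeff_nonneg {b ξ : Fin 3 → ℝ} (h : WeaklySupermajorizedBy b ξ) :
    0 ≤ newtonCoeff b ξ := by
  obtain ⟨⟨hb0, hb1, hb2⟩, ⟨hb01, hb12, hb02⟩, htotal⟩ := weaklySupermajorizedBy_fin_three_iff.1 h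
  -- The coefficient is symmetric in `b`, and two of the `b i` lie on the same side of `ξ 1`.
  have hmiddle : 0 ≤ (b 0 - ξ 1) * (b 1 - ξ 1) + (b 2 - ξ 0) * (b 0 + b 1 - ξ 0 - ξ 1) := by
    rcases mul_nonneg_or_mul_nonneg_or_mul_nonneg (b 0 - ξ 1) (b 1 - ξ 1) (b 2 - ξ 1)
      with h01 | h12 | h02
    · linarith [mul_nonneg (sub_nonneg.2 hb2) (sub_nonneg.2 hb01)]
    · linarith [mul_nonneg (sub_nonneg.2 hb0) (sub_nonneg.2 hb12)]
    · linarith [mul_nonneg (sub_nonneg.2 hb1) (sub_nonneg.2 hb02)]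
  have hprod : 0 ≤ ∏ i, (b i - ξ 0) := prod_nonneg fun i _ => sub_nonneg.2 (h.le_apply i)
  have hsum : 0 ≤ ∑ i, b i - ∑ i, ξ i := by simpa [Fin.sum_univ_three] using htotal
  intro i
  fin_cases i
  exacts [hprod, hmiddle, hsum]

end NewtonCoefficients

section Pochhammer

open Finset

theorem ascPochhammer_eval_eq_prod_range {S : Type*} [CommSemiring S] (n : ℕ) (c : S) :
    (ascPochhammer S n).eval c = ∏ j ∈ range n, (c + j) := by
  induction n with
  | zero => simp
  | succ n ih => rw [ascPochhammer_succ_eval, prod_range_succ, ih]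

theorem ascPochhammer_eval_add {S : Type*} [CommSemiring S] (m n : ℕ) (c : S) :
    (ascPochhammer S (m + n)).eval c =
      (ascPochhammer S m).eval c * (ascPochhammer S n).eval (c + m) := by
  simp [← ascPochhammer_mul]

theorem pow_le_ascPochhammer_eval (n : ℕ) {c : ℝ} (hc : 0 ≤ c) :
    c ^ n ≤ (ascPochhammer ℝ n).eval c := by
  rw [ascPochhammer_eval_eq_prod_range]
  simpa using prod_le_prod (s := range n) (fun _ _ => hc) fun j _ => le_add_of_nonneg_right
    (Nat.cast_nonneg (α := ℝ) j)

theorem ascPochhammer_eval_two_mul {K : Type*} [Field K] [NeZero (2 : K)] (n : ℕ) (a : K) :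
    (ascPochhammer K (2 * n)).eval (2 * a) =
      4 ^ n * (ascPochhammer K n).eval a * (ascPochhammer K n).eval (a + 1 / 2) := by
  induction n with
  | zero => simp
  | succ n ih =>
    have h2 := two_ne_zero (α := K)
    rw [show 2 * (n + 1) = 2 * n + 1 + 1 by ring]
    simp only [ascPochhammer_succ_eval, ih]
    push_cast
    field_simp
    ring

theorem ascPochhammer_eval_two_mul_add_natCast (n : ℕ) {a : ℝ} (ha : 0 < a) :
    (ascPochhammer ℝ n).eval (2 * a + n) =
      4 ^ n * (ascPochhammer ℝ n).eval a * (ascPochhammer ℝ n).eval (a + 1 / 2) /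
        (ascPochhammer ℝ n).eval (2 * a) := by
  rw [← ascPochhammer_eval_two_mul, two_mul n, ascPochhammer_eval_add,
    mul_div_cancel_left₀ _ (ascPochhammer_pos n _ (by positivity)).ne']

-- Chu–Vandermonde for the falling factorials of `d + n - 1` and `c + n - 1`, reversed.
theorem sum_choose_mul_ascPochhammer_eval {R : Type*} [CommRing R] (n : ℕ) (c d : R) :
    ∑ ij ∈ antidiagonal n, (n.choose ij.1 : R) *
      ((ascPochhammer R ij.1).eval (d + ij.2) * (ascPochhammer R ij.2).eval (c + ij.1)) =
      (ascPochhammer R n).eval (c + d + n - 1) := by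
  have hvandermonde := Ring.descPochhammer_smeval_add n (Commute.all (d + n - 1) (c + n - 1))
  simp only [Polynomial.descPochhammer_smeval_eq_ascPochhammer,
    Polynomial.ascPochhammer_smeval_eq_eval] at hvandermonde
  rw [show c + d + n - 1 = d + n - 1 + (c + n - 1) - n + 1 by ring, hvandermonde]
  refine sum_congr rfl fun ij hij => ?_
  rw [← mem_antidiagonal.1 hij]
  push_cast
  ring_nf

/-- The hypergeometric function `₀F₁[c | z]`, a normalised Bessel function. Its square is `₂F₃` at
the parameters `basePoint`. -/
noncomputable def zeroFOne (c z : ℝ) : ℝ :=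
  ∑' n : ℕ, z ^ n / (n.factorial * (ascPochhammer ℝ n).eval c)

theorem summable_norm_zeroFOne {c : ℝ} (hc : 0 < c) (z : ℝ) :
    Summable fun n : ℕ => ‖z ^ n / (n.factorial * (ascPochhammer ℝ n).eval c)‖ := by
  refine Summable.of_nonneg_of_le (fun n => norm_nonneg _) (fun n => ?_)
    (Real.summable_pow_div_factorial (|z| / c))
  have hp := ascPochhammer_pos n c hc
  rw [norm_div, norm_mul, norm_pow, Real.norm_natCast, Real.norm_eq_abs, Real.norm_of_nonneg hp.le,
    div_pow, div_div, mul_comm (c ^ n)]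
  gcongr
  exact pow_le_ascPochhammer_eval n hc.le

theorem zeroFOne_term_mul_term {c d : ℝ} (hc : 0 < c) (hd : 0 < d) (z : ℝ) (i j : ℕ) :
    z ^ i / (i.factorial * (ascPochhammer ℝ i).eval c) *
      (z ^ j / (j.factorial * (ascPochhammer ℝ j).eval d)) =
    z ^ (i + j) / ((i + j).factorial *
        ((ascPochhammer ℝ (i + j)).eval c * (ascPochhammer ℝ (i + j)).eval d)) *
      ((i + j).choose i *
        ((ascPochhammer ℝ i).eval (d + j) * (ascPochhammer ℝ j).eval (c + i))) := by
  have hchoose : ((i + j).factorial : ℝ) = (i + j).choose i * i.factorial * j.factorial := by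
    rw [Nat.choose_symm_add]
    exact_mod_cast (Nat.add_choose_mul_factorial_mul_factorial i j).symm
  have hci := (ascPochhammer_pos i c hc).ne'
  have hdj := (ascPochhammer_pos j d hd).ne'
  have hcj := (ascPochhammer_pos j (c + i) (by positivity)).ne'
  have hdi := (ascPochhammer_pos i (d + j) (by positivity)).ne'
  have hbinom : ((i + j).choose i : ℝ) ≠ 0 :=
    Nat.cast_ne_zero.2 (Nat.choose_pos (Nat.le_add_right i j)).ne'
  have hd_split : (ascPochhammer ℝ (i + j)).eval d =
      (ascPochhammer ℝ j).eval d * (ascPochhammer ℝ i).eval (d + j) := by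
    rw [add_comm, ascPochhammer_eval_add]
  rw [hchoose, ascPochhammer_eval_add i j c, hd_split, pow_add]
  field_simp

theorem zeroFOne_mul_zeroFOne {c d : ℝ} (hc : 0 < c) (hd : 0 < d) (z : ℝ) :
    zeroFOne c z * zeroFOne d z =
      ∑' n : ℕ, z ^ n / (n.factorial * ((ascPochhammer ℝ n).eval c * (ascPochhammer ℝ n).eval d)) *
        (ascPochhammer ℝ n).eval (c + d + n - 1) := by
  rw [zeroFOne, zeroFOne, tsum_mul_tsum_eq_tsum_sum_antidiagonal_of_summable_norm
    (summable_norm_zeroFOne hc z) (summable_norm_zeroFOne hd z)]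
  refine tsum_congr fun n => ?_
  rw [← sum_choose_mul_ascPochhammer_eval, mul_sum]
  refine sum_congr rfl fun ij hij => ?_
  rw [zeroFOne_term_mul_term hc hd, mem_antidiagonal.1 hij]

end Pochhammer

section TwoFThree

open Finset

theorem twoFThreeTerm_eq_prod (a₁ a₂ : ℝ) (b : Fin 3 → ℝ) (z : ℝ) (n : ℕ) :
    twoFThreeTerm a₁ a₂ b z n = (ascPochhammer ℝ n).eval a₁ * (ascPochhammer ℝ n).eval a₂ /
      (n.factorial * ∏ i, (ascPochhammer ℝ n).eval (b i)) * z ^ n := by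
  rw [twoFThreeTerm, Fin.prod_univ_three]

theorem twoFThreeTerm_comp_perm (a₁ a₂ : ℝ) (b : Fin 3 → ℝ) (σ : Equiv.Perm (Fin 3)) :
    twoFThreeTerm a₁ a₂ (b ∘ σ) = twoFThreeTerm a₁ a₂ b := by
  funext z n
  simp only [twoFThreeTerm_eq_prod, Function.comp_apply,
    Equiv.prod_comp σ fun i => (ascPochhammer ℝ n).eval (b i)]

theorem twoFThreeTerm_neg (a₁ a₂ : ℝ) (b : Fin 3 → ℝ) (t : ℝ) (n : ℕ) :
    twoFThreeTerm a₁ a₂ b (-t) n = twoFThreeTerm a₁ a₂ b (-1) n * t ^ n := by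
  simp only [twoFThreeTerm, neg_pow t, mul_assoc]

theorem twoFThree_neg (a₁ a₂ : ℝ) (b : Fin 3 → ℝ) (t : ℝ) :
    twoFThree a₁ a₂ b (-t) = ∑' n, twoFThreeTerm a₁ a₂ b (-1) n * t ^ n :=
  tsum_congr fun n => by rw [twoFThreeTerm_neg]

theorem twoFThree_basePoint {a₁ a₂ : ℝ} (ha₁ : 0 < a₁) (ha₂ : 0 < a₂) (z : ℝ) :
    twoFThree a₁ a₂ (basePoint a₁ a₂) z = zeroFOne (a₁ + 1 / 2) (z / 4) ^ 2 := by
  have hc : 0 < a₁ + 1 / 2 := by positivity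
  rw [sq, zeroFOne_mul_zeroFOne hc hc]
  refine tsum_congr fun n => ?_
  have h₂ := (ascPochhammer_pos n a₂ ha₂).ne'
  rw [show a₁ + 1 / 2 + (a₁ + 1 / 2) + n - 1 = 2 * a₁ + n by ring,
    ascPochhammer_eval_two_mul_add_natCast n ha₁]
  simp only [twoFThreeTerm, basePoint, Matrix.cons_val, div_pow]
  field_simp

theorem prod_range_newtonRatio {b ξ : Fin 3 → ℝ} (hξ : ∀ i, 0 < ξ i) (n : ℕ) :
    ∏ j ∈ range n, newtonRatio (newtonCoeff b ξ) ξ j =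
      (∏ i, (ascPochhammer ℝ n).eval (b i)) / ∏ i, (ascPochhammer ℝ n).eval (ξ i) := by
  have hne (j : ℕ) (i : Fin 3) : (j : ℝ) + ξ i ≠ 0 :=
    (add_pos_of_nonneg_of_pos j.cast_nonneg (hξ i)).ne'
  simp only [newtonRatio_newtonCoeff (hne _), prod_div_distrib, ascPochhammer_eval_eq_prod_range,
    prod_comm (s := range n), add_comm]

theorem twoFThreeTerm_eq_div_prod {a₁ a₂ : ℝ} {b ξ : Fin 3 → ℝ} (hξ : ∀ i, 0 < ξ i) (z : ℝ)
    (n : ℕ) :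
    twoFThreeTerm a₁ a₂ b z n =
      twoFThreeTerm a₁ a₂ ξ z n / ∏ j ∈ range n, newtonRatio (newtonCoeff b ξ) ξ j := by
  have hne : ∏ i, (ascPochhammer ℝ n).eval (ξ i) ≠ 0 :=
    prod_ne_zero_iff.2 fun i _ => (ascPochhammer_pos n _ (hξ i)).ne'
  rw [twoFThreeTerm_eq_prod, twoFThreeTerm_eq_prod, prod_range_newtonRatio hξ]
  field_simp

theorem nonnegSeries_twoFThreeTerm_of_weaklySupermajorizedBy {a₁ a₂ : ℝ} {b ξ : Fin 3 → ℝ}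
    (hξ : ∀ i, 0 < ξ i) (hb : WeaklySupermajorizedBy b ξ)
    (hc : NonnegSeries (twoFThreeTerm a₁ a₂ ξ (-1))) :
    NonnegSeries (twoFThreeTerm a₁ a₂ b (-1)) := by
  rw [funext (twoFThreeTerm_eq_div_prod (b := b) hξ (-1))]
  exact hc.div_prod_range (isShiftMultiplier_newtonRatio (newtonCoeff_nonneg hb) hξ)

theorem twoFThree_neg_pos_of_weaklySupermajorizedBy {a₁ a₂ : ℝ} {b ξ : Fin 3 → ℝ}
    (hξ : ∀ i, 0 < ξ i) (hb : WeaklySupermajorizedBy b ξ)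
    (hc : NonnegSeries (twoFThreeTerm a₁ a₂ ξ (-1)))
    (hbξ : b ∉ Set.range fun σ : Equiv.Perm (Fin 3) => ξ ∘ σ) {t : ℝ} (ht : 0 ≤ t) :
    0 < twoFThree a₁ a₂ b (-t) := by
  have hC : 0 < newtonCoeff b ξ :=
    (newtonCoeff_nonneg hb).lt_of_ne' fun h => hbξ (exists_perm_of_newtonCoeff_eq_zero h)
  have hc0 : 0 < twoFThreeTerm a₁ a₂ ξ (-1) 0 := by simp [twoFThreeTerm]
  rw [twoFThree_neg, funext (twoFThreeTerm_eq_div_prod (b := b) hξ (-1))]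
  exact hc.tsum_div_prod_range_pos (isShiftMultiplier_newtonRatio hC.le hξ) hc0
    fun d hd hd0 => hd.tsum_mul_newtonRatio_pos hd0 hC hξ ht

theorem nonnegSeries_twoFThreeTerm_xi {a₁ a₂ : ℝ} (ha₁ : 0 < a₁) (ha₂ : 0 < a₂) :
    NonnegSeries (twoFThreeTerm a₁ a₂ (xi a₁ a₂) (-1)) where
  summable t := by
    simp only [← twoFThreeTerm_neg]
    exact summable_twoFThreeTerm ha₁ ha₂ (xi_pos ha₁ ha₂) (-t)
  nonneg t _ := by
    rw [← twoFThree_neg, twoFThree, xi, twoFThreeTerm_comp_perm, ← twoFThree,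
      twoFThree_basePoint ha₁ ha₂]
    exact sq_nonneg _

end TwoFThree

theorem theorem2_general (a₁ a₂ : ℝ) (ha₁ : 0 < a₁) (ha₂ : 0 < a₂) :
    (∀ b ∈ newtonPolyhedron (vertexSet a₁ a₂),
      (∀ x : ℝ, 0 ≤ twoFThree a₁ a₂ b (-x ^ 2)) ∧
      (b ∉ vertexSet a₁ a₂ → ∀ x : ℝ, 0 < twoFThree a₁ a₂ b (-x ^ 2))) ∧
    (∀ b : Fin 3 → ℝ, b ∈ newtonPolyhedron (vertexSet a₁ a₂) ↔
      (xi a₁ a₂ 0 ≤ b 0 ∧ xi a₁ a₂ 0 ≤ b 1 ∧ xi a₁ a₂ 0 ≤ b 2) ∧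
      (xi a₁ a₂ 0 + xi a₁ a₂ 1 ≤ b 0 + b 1 ∧
        xi a₁ a₂ 0 + xi a₁ a₂ 1 ≤ b 1 + b 2 ∧
        xi a₁ a₂ 0 + xi a₁ a₂ 1 ≤ b 0 + b 2) ∧
      3 * a₁ + a₂ + 1 / 2 ≤ b 0 + b 1 + b 2) := by
  have hξ := xi_pos ha₁ ha₂
  have hc := nonnegSeries_twoFThreeTerm_xi ha₁ ha₂
  refine ⟨fun b hb => ?_, fun b => ?_⟩
  · rw [mem_newtonPolyhedron_vertexSet_iff] at hb
    refine ⟨fun x => ?_, fun hbv x => ?_⟩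
    · rw [twoFThree_neg]
      exact (nonnegSeries_twoFThreeTerm_of_weaklySupermajorizedBy hξ hb hc).nonneg _ (sq_nonneg x)
    · rw [vertexSet_eq_range_xi_comp] at hbv
      exact twoFThree_neg_pos_of_weaklySupermajorizedBy hξ hb hc hbv (sq_nonneg x)
  · rw [mem_newtonPolyhedron_vertexSet_iff, weaklySupermajorizedBy_fin_three_iff, sum_xi]

theorem theorem2 (a₁ a₂ : ℝ) (ha₁ : 0 < a₁) (ha₂ : 0 < a₂) :
    ((a₁, a₂) ∈ admissible →
      ∀ b ∈ newtonPolyhedron (vertexSet a₁ a₂),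
        (∀ x : ℝ, 0 < x → 0 ≤ twoFThree a₁ a₂ b (-x ^ 2)) ∧
        (b ∉ vertexSet a₁ a₂ → ∀ x : ℝ, 0 < x → 0 < twoFThree a₁ a₂ b (-x ^ 2))) ∧
    (∀ b : Fin 3 → ℝ, b ∈ newtonPolyhedron (vertexSet a₁ a₂) ↔
      (xi a₁ a₂ 0 ≤ b 0 ∧ xi a₁ a₂ 0 ≤ b 1 ∧ xi a₁ a₂ 0 ≤ b 2) ∧
      (xi a₁ a₂ 0 + xi a₁ a₂ 1 ≤ b 0 + b 1 ∧
        xi a₁ a₂ 0 + xi a₁ a₂ 1 ≤ b 1 + b 2 ∧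
        xi a₁ a₂ 0 + xi a₁ a₂ 1 ≤ b 0 + b 2) ∧
      3 * a₁ + a₂ + 1 / 2 ≤ b 0 + b 1 + b 2) := by
  obtain ⟨hsign, hmem⟩ := theorem2_general a₁ a₂ ha₁ ha₂
  exact ⟨fun _ b hb => ⟨fun x _ => (hsign b hb).1 x, fun hbv x _ => (hsign b hb).2 hbv x⟩, hmem⟩
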